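/- Let $\mathbb{G}=(\mathcal V,\mathcal E)$ be an undirected simple graph on the agents $\mathcal V=\{1,\dots,m\}$, let $\mathcal N_i$ be the set of neighbors of $i$, and for each pair of neighbors $(i,j)$ let $A_{ij}\in\mathbb{R}^{d_{ij}\times n}$ and $\boldsymbol b_{ij}\in\mathbb{R}^{d_{ij}}$, where $A_{ij}A_{ij}'$ is invertible. Let $\boldsymbol f_i:\mathbb{R}^n\to\mathbb{R}$ for $i\in\mathcal V$, and consider the problem $$\min_{\boldsymbol x_1,\dots,\boldsymbol x_m\in\mathbb{R}^n}\ \sum_{i=1}^m \boldsymbol f_i(\boldsymbol x_i)\quad\text{subject to}\quad A_{ij}(\boldsymbol x_i-\boldsymbol x_j)=\boldsymbol b_{ij}\ \text{ for all }(i,j)\in\mathcal E. \qquad (\ast)$$ Put $P_{ij}=A_{ij}'(A_{ij}A_{ij}')^{-1}A_{ij}$ and $\bar{\boldsymbol b}_{ij}=A_{ij}'(A_{ij}A_{ij}')^{-1}\boldsymbol b_{ij}$. Orient the edges arbitrarily, writing the $l$-th edge as an ordered pair $(i_l,j_l)$, $l=1,\dots,\bar m$. Let $H\in\mathbb{R}^{\bar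 m\times m}$ be the incidence matrix whose $l$-th row has $1$ in column $i_l$, $-1$ in column $j_l$ and $0$ elsewhere, and let $\bar H=H\otimes I_n$ and $\bar P=\mathrm{diag}\{P_{i_1,j_1},\dots,P_{i_{\bar m},j_{\bar m}}\}$. Assume that (1) the problem $(\ast)$ has a solution; (2) the edge constraints are consistent: $d_{ij}=d_{ji}$, $A_{ij}=A_{ji}$ and $\boldsymbol b_{ij}=-\boldsymbol b_{ji}$ for all pairs of neighbors; (3) $\mathbb{G}$ is connected and well-configured, i.e. $\ker\bar H'\cap\operatorname{image}\bar P=\{\boldsymbol 0\}$; (4) each $\boldsymbol f_i$ is continuously differentiable and convex, and $\boldsymbol f(\boldsymbol x)=\sum_{i=1}^m\boldsymbol f_i(\boldsymbol x_i)$ is strictly convex on $\mathbb{R}^{mn}$. Then for any initial values $\boldsymbol x_i(0),\boldsymbol\lambda_i(0)\in\mathbb{R}^n$, $i\in\mathcal V$, the primal–dual dynamics $$\dot{\boldsymbol x}_i=-\nabla\boldsymbol f_i(\boldsymbol x_i)-\sum_{j\in\mathcal N_i}P_{ij}(\boldsymbol\lambda_i-\boldsymbol\lambda_j)-\sum_{j\in\mathcal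 N_i}P_{ij}(\boldsymbol x_i-\boldsymbol x_j-\bar{\boldsymbol b}_{ij}),\qquad \dot{\boldsymbol\lambda}_i=\sum_{j\in\mathcal N_i}P_{ij}(\boldsymbol x_i-\boldsymbol x_j-\bar{\boldsymbol b}_{ij})$$ have a solution on $[0,\infty)$, and along every such solution each $\boldsymbol x_i(t)$ converges as $t\to\infty$ to a constant $\boldsymbol x_i^*$, where $(\boldsymbol x_1^*,\dots,\boldsymbol x_m^*)$ solves $(\ast)$, and each $\boldsymbol\lambda_i(t)$ converges to a constant as well. -/

import Mathlib

open Matrix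
open scoped Kronecker

noncomputable section

/-- The data of a multi-agent optimization problem with `m` agents, whose states lie in `ℝⁿ`:
an undirected graph, for every pair `(i, j)` a matrix `A i j` with `d i j` rows and a vector `b i j`
(only the pairs that are edges of the graph matter), and a private objective `f i` of every agent. -/
structure EdgeAgreementProblem (m n : ℕ) where
  /-- the communication graph -/
  G : SimpleGraph (Fin m)
  /-- the dimension of the agreement along an edge -/
  d : Fin m → Fin m → ℕ
  /-- the agreement matrices -/
  A : (i j : Fin m) → Matrix (Fin (d i j)) (Fin n) ℝ
  /-- the agreement vectors -/
  b : (i j : Fin m) → (Fin (d i j) → ℝ)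
  /-- the private objectives -/
  f : Fin m → EuclideanSpace ℝ (Fin n) → ℝ

namespace EdgeAgreementProblem

variable {m n : ℕ} (p : EdgeAgreementProblem m n)

/-- The global objective `f(x) = ∑ i, f i (x i)` on `(ℝⁿ)ᵐ`. -/
def objective (x : Fin m → EuclideanSpace ℝ (Fin n)) : ℝ :=
  ∑ i, p.f i (x i)

/-- The stacked states that meet all edge agreements `A i j (x i - x j) = b i j`. -/
def feasibleSet : Set (Fin m → EuclideanSpace ℝ (Fin n)) :=
  {x | ∀ i j, p.G.Adj i j → p.A i j *ᵥ (x i - x j).ofLp = p.b i j}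

/-- `x` solves the problem: it minimizes the objective under the edge agreements. -/
def IsSolution (x : Fin m → EuclideanSpace ℝ (Fin n)) : Prop :=
  x ∈ p.feasibleSet ∧ IsMinOn p.objective p.feasibleSet x

/-- Consistency: `d i j = d j i`, `A i j = A j i` and `b i j = - b j i` on every edge. -/
def Consistent : Prop :=
  ∀ i j, p.G.Adj i j → ∃ h : p.d i j = p.d j i,
    p.A i j = (p.A j i).submatrix (Fin.cast h) id ∧
    p.b i j = fun k => - p.b j i (Fin.cast h k)

/-- `A i j (A i j)ᵀ` is invertible on every edge, so that its inverse below is meaningful. -/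
def FullRowRank : Prop :=
  ∀ i j, p.G.Adj i j → IsUnit (p.A i j * (p.A i j)ᵀ)

/-- The projection matrix `P i j = Aᵀ (A Aᵀ)⁻¹ A` with `A = A i j`. -/
def P (i j : Fin m) : Matrix (Fin n) (Fin n) ℝ :=
  (p.A i j)ᵀ * (p.A i j * (p.A i j)ᵀ)⁻¹ * p.A i j

/-- The vector `bbar i j = Aᵀ (A Aᵀ)⁻¹ b` with `A = A i j`, `b = b i j`. -/
def bbar (i j : Fin m) : EuclideanSpace ℝ (Fin n) :=
  WithLp.toLp 2 (((p.A i j)ᵀ * (p.A i j * (p.A i j)ᵀ)⁻¹) *ᵥ p.b i j)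

/-- An orientation of the graph: every edge `e` is written as an ordered pair `(i, j)`, namely
`i = (o e).fst` and `j = (o e).snd`. As an arrow, the edge goes from `j` to `i`. -/
structure Orientation where
  /-- the ordered pair of an edge -/
  toDart : p.G.edgeSet → p.G.Dart
  /-- it is an ordering of the two ends of that edge -/
  edge_toDart : ∀ e, (toDart e).edge = e

variable {p} in
/-- The oriented incidence matrix `H`, rows indexed by edges: `1` where the edge comes in, `-1`
where it goes out, `0` elsewhere, so that the row of `(i, j)` gives `x i - x j`. -/
def Orientation.H (o : p.Orientation) : Matrix p.G.edgeSet (Fin m) ℝ :=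
  Matrix.of fun e v =>
    if v = (o.toDart e).fst then 1 else if v = (o.toDart e).snd then -1 else 0

variable {p} in
/-- `Hbar = H ⊗ Iₙ`. -/
def Orientation.Hbar (o : p.Orientation) : Matrix (p.G.edgeSet × Fin n) (Fin m × Fin n) ℝ :=
  o.H ⊗ₖ (1 : Matrix (Fin n) (Fin n) ℝ)

variable {p} in
open scoped Classical in
/-- `Pbar`, the block-diagonal matrix of the projections `P i j`, one block for every edge. -/
def Orientation.Pbar (o : p.Orientation) :
    Matrix (p.G.edgeSet × Fin n) (p.G.edgeSet × Fin n) ℝ :=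
  (Matrix.blockDiagonal fun e => p.P (o.toDart e).fst (o.toDart e).snd).submatrix
    Prod.swap Prod.swap

variable {p} in
open scoped Classical in
/-- The graph is well-configured: `ker Hbarᵀ ∩ image Pbar = 0`. -/
def Orientation.WellConfigured (o : p.Orientation) : Prop :=
  LinearMap.ker (Matrix.mulVecLin o.Hbarᵀ) ⊓ LinearMap.range (Matrix.mulVecLin o.Pbar) = ⊥

open scoped Classical in
/-- `∑ j ∈ N i, P i j (x i - x j - bbar i j)`. -/
def agreementTerm (x : Fin m → EuclideanSpace ℝ (Fin n)) (i : Fin m) :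
    EuclideanSpace ℝ (Fin n) :=
  ∑ j ∈ p.G.neighborFinset i, Matrix.toEuclideanLin (p.P i j) (x i - x j - p.bbar i j)

open scoped Classical in
/-- `∑ j ∈ N i, P i j (l i - l j)`. -/
def multiplierTerm (l : Fin m → EuclideanSpace ℝ (Fin n)) (i : Fin m) :
    EuclideanSpace ℝ (Fin n) :=
  ∑ j ∈ p.G.neighborFinset i, Matrix.toEuclideanLin (p.P i j) (l i - l j)

/-- `(x, l)` is a trajectory on `[0, ∞)` of the distributed primal-dual dynamics
`x i' = - ∇ f i (x i) - ∑ j ∈ N i, P i j (l i - l j) - ∑ j ∈ N i, P i j (x i - x j - bbar i j)`,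
`l i' = ∑ j ∈ N i, P i j (x i - x j - bbar i j)` (the derivative at time `0` is one-sided). -/
def IsTrajectory (x l : ℝ → Fin m → EuclideanSpace ℝ (Fin n)) : Prop :=
  ∀ t, 0 ≤ t → ∀ i,
    HasDerivWithinAt (fun s => x s i)
      (- gradient (p.f i) (x t i) - p.multiplierTerm (l t) i - p.agreementTerm (x t) i)
      (Set.Ici 0) t ∧
    HasDerivWithinAt (fun s => l s i) (p.agreementTerm (x t) i) (Set.Ici 0) t

end EdgeAgreementProblem

end

/-! Stack the unknowns as `z = (x, l)`, so that the dynamics reads `z' = - F z` with `F =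
saddleField`. Let `L` be the linear operator `multiplierTerm`, a graph Laplacian weighted by the
projections `P i j`; it is symmetric and positive semidefinite. In `⟪F z - F w, z - w⟫` the skew
coupling of `x` and `l` through `L` cancels, leaving the monotonicity of the gradients plus the
quadratic form of `L`. Hence `F` is monotone, and the distance between two flow lines never
increases.

An equilibrium exists: at a solution of the problem the gradient is orthogonal to `ker L`, so it
lies in the range of `L` and a multiplier exists (`exists_multiplier`).

The gradients are only continuous, so a flow is built from delay equations; monotonicity makes these
approximations Cauchy (`exists_isFlowLine`). Convergence is a LaSalle argument (`exists_tendsto`): a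
limiting flow line keeps its distance to an equilibrium, strict convexity then freezes its primal
part, and so it starts at an equilibrium. Contraction towards this equilibrium turns subsequential
convergence into convergence. Strict convexity also forces all equilibria to share the primal part,
namely the given solution. -/

section

open Set Filter Topology

/-! ### Monotone fields and the contraction of their flows -/

/-- A vector field is monotone if `⟪F x - F y, x - y⟫ ≥ 0`. -/
def IsMonotoneField {Z : Type*} [NormedAddCommGroup Z] [InnerProductSpace ℝ Z] (F : Z → Z) : Prop :=
  ∀ x y, 0 ≤ inner ℝ (F x - F y) (x - y)

/-- `z` solves `z' = - F z` on `S`. -/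
def IsFlowLine {Z : Type*} [NormedAddCommGroup Z] [InnerProductSpace ℝ Z] (F : Z → Z) (S : Set ℝ)
    (z : ℝ → Z) : Prop :=
  ∀ t ∈ S, HasDerivWithinAt z (-F (z t)) S t

theorem image_sub_le_of_hasDerivWithinAt_le {S : Set ℝ} (hS : Convex ℝ S) {φ φ' : ℝ → ℝ} {C : ℝ}
    (h : ∀ t ∈ S, HasDerivWithinAt φ (φ' t) S t) (hC : ∀ t ∈ S, φ' t ≤ C) {s t : ℝ}
    (hs : s ∈ S) (ht : t ∈ S) (hst : s ≤ t) : φ t - φ s ≤ C * (t - s) := by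
  have hd : ∀ x ∈ interior S, HasDerivAt φ (φ' x) x := fun x hx =>
    (h x (interior_subset hx)).hasDerivAt (mem_interior_iff_mem_nhds.1 hx)
  refine hS.image_sub_le_mul_sub_of_deriv_le (fun x hx => (h x hx).continuousWithinAt)
    (fun x hx => (hd x hx).differentiableAt.differentiableWithinAt) (fun x hx => ?_) s hs t ht hst
  rw [(hd x hx).deriv]
  exact hC x (interior_subset hx)

section
variable {Z : Type*} [NormedAddCommGroup Z] [InnerProductSpace ℝ Z] {F : Z → Z}

theorem IsFlowLine.mono {S S' : Set ℝ} {z : ℝ → Z} (h : IsFlowLine F S z) (hS : S' ⊆ S) :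
    IsFlowLine F S' z := fun t ht => (h t (hS ht)).mono hS

/-- The derivative of `‖z - w‖ ^ 2` is `-2 ⟪z - w, F z - F w⟫ ≤ 0`. -/
theorem IsMonotoneField.antitoneOn_norm_sub (hF : IsMonotoneField F) {S : Set ℝ}
    (hS : Convex ℝ S) {z w : ℝ → Z} (hz : IsFlowLine F S z) (hw : IsFlowLine F S w) :
    AntitoneOn (fun t => ‖z t - w t‖) S := by
  intro s hs t ht hst
  have := image_sub_le_of_hasDerivWithinAt_le hS (C := 0)
    (fun t ht => ((hz t ht).fun_sub (hw t ht)).norm_sq) (fun t _ => by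
      have h := hF (z t) (w t)
      rw [real_inner_comm] at h
      have : -F (z t) - -F (w t) = -(F (z t) - F (w t)) := by abel
      rw [this, inner_neg_right]
      linarith) hs ht hst
  have h2 : ‖z t - w t‖ ^ 2 ≤ ‖z s - w s‖ ^ 2 := by linarith
  exact (sq_le_sq₀ (norm_nonneg _) (norm_nonneg _)).1 h2

theorem IsMonotoneField.norm_flow_sub_le (hF : IsMonotoneField F) {z w : ℝ → Z}
    (hz : IsFlowLine F (Ici 0) z) (hw : IsFlowLine F (Ici 0) w) {s t : ℝ} (hs : 0 ≤ s)
    (hst : s ≤ t) : ‖z t - w t‖ ≤ ‖z s - w s‖ :=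
  hF.antitoneOn_norm_sub (convex_Ici 0) hz hw hs (hs.trans hst : (0:ℝ) ≤ t) hst

theorem IsMonotoneField.eqOn_of_initial (hF : IsMonotoneField F) {T : ℝ} {z w : ℝ → Z}
    (hz : IsFlowLine F (Icc 0 T) z) (hw : IsFlowLine F (Icc 0 T) w) (h0 : z 0 = w 0) :
    EqOn z w (Icc 0 T) := by
  intro t ht
  have := hF.antitoneOn_norm_sub (convex_Icc 0 T) hz hw ⟨le_rfl, ht.1.trans ht.2⟩ ht ht.1
  simp only [h0, sub_self, norm_zero] at this
  exact sub_eq_zero.1 (norm_le_zero_iff.1 this)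

theorem isFlowLine_const {S : Set ℝ} {e : Z} (he : F e = 0) : IsFlowLine F S (fun _ => e) := by
  intro t _
  simpa [he] using hasDerivWithinAt_const t S e

theorem IsFlowLine.comp_add {z : ℝ → Z} (hz : IsFlowLine F (Ici 0) z) {a : ℝ} (ha : 0 ≤ a) :
    IsFlowLine F (Ici 0) (fun t => z (t + a)) := by
  intro t ht
  have h1 := hz (t + a) (add_nonneg ht ha)
  have h2 : HasDerivWithinAt (fun s : ℝ => s + a) 1 (Ici 0) t :=
    ((hasDerivAt_id t).add_const a).hasDerivWithinAt
  have := h1.scomp t h2 (fun s (hs : 0 ≤ s) => add_nonneg hs ha)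
  simpa [Function.comp_def] using this

/-! ### Existence of flow lines for continuous monotone fields -/

/-- The delay equation `u' t = G (u (max (t - h) 0))` is solved by finitely many integrations. -/
theorem exists_delay_solution [CompleteSpace Z] {G : Z → Z} (hG : Continuous G) (z₀ : Z) {h : ℝ}
    (hh : 0 < h) (T : ℝ) :
    ∃ u : ℝ → Z, u 0 = z₀ ∧ Continuous u ∧
      ∀ t ∈ Icc 0 T, HasDerivAt u (G (u (max (t - h) 0))) t := by
  let g : ℕ → ℝ → Z := fun k => Nat.rec (fun _ => z₀)
    (fun _ v t => z₀ + ∫ s in (0:ℝ)..t, G (v (max (s - h) 0))) k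
  have gs : ∀ k t, g (k + 1) t = z₀ + ∫ s in (0:ℝ)..t, G (g k (max (s - h) 0)) := fun _ _ => rfl
  have hd : ∀ k, Continuous (g k) ∧
      ∀ t, HasDerivAt (g (k + 1)) (G (g k (max (t - h) 0))) t := by
    have step : ∀ k, Continuous (g k) →
        ∀ t, HasDerivAt (g (k + 1)) (G (g k (max (t - h) 0))) t := by
      intro k hk t
      have hc : Continuous fun s => G (g k (max (s - h) 0)) := by fun_prop
      have := (hc.integral_hasStrictDerivAt 0 t).hasDerivAt.const_add z₀
      exact this
    intro k
    induction k with
    | zero =>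
      have h0 : Continuous (g 0) := continuous_const
      exact ⟨h0, step 0 h0⟩
    | succ k ih =>
      have h0 : Continuous (g (k + 1)) :=
        continuous_iff_continuousAt.2 fun t => (ih.2 t).continuousAt
      exact ⟨h0, step (k + 1) h0⟩
  -- Iterate `k` is already final on `[0, k * h]`, because up to time `(k + 1) * h` the integrand
  -- only looks at times up to `k * h`.
  have stab : ∀ k : ℕ, ∀ t, 0 ≤ t → t ≤ k * h → g (k + 1) t = g k t := by
    intro k
    induction k with
    | zero =>
      intro t h0 h1
      have : t = 0 := le_antisymm (by simpa using h1) h0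
      subst this
      rw [gs]; simp [g]
    | succ k ih =>
      intro t h0 h1
      rw [gs (k + 1), gs k]
      congr 1
      refine intervalIntegral.integral_congr fun s hs => ?_
      rw [uIcc_of_le h0] at hs
      rw [ih _ (le_max_right _ _)]
      refine max_le ?_ (by positivity)
      push_cast at h1
      linarith [hs.2]
  obtain ⟨N, hN⟩ := exists_nat_ge (T / h)
  have hN' : T ≤ N * h := (div_le_iff₀ hh).1 hN
  refine ⟨g (N + 1), by rw [gs]; simp, (hd (N + 1)).1, fun t ht => ?_⟩
  have := (hd N).2 t
  rwa [← stab N (max (t - h) 0) (le_max_right _ _)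
    (max_le (by linarith [ht.2]) (by positivity))] at this

/-- The radial retraction onto a closed ball. -/
theorem exists_radial_retraction (e : Z) {r : ℝ} (hr : 0 < r) :
    ∃ ρ : Z → Z, Continuous ρ ∧ (∀ z, ‖ρ z - e‖ ≤ r) ∧ (∀ z, ‖z - e‖ ≤ r → ρ z = z) ∧
      ∀ z, ∃ c : ℝ, 0 ≤ c ∧ z - e = c • (ρ z - e) := by
  have hm : ∀ z, 0 < max r ‖z - e‖ := fun z => lt_max_of_lt_left hr
  refine ⟨fun z => e + (r / max r ‖z - e‖) • (z - e), ?_, fun z => ?_, fun z hz => ?_, fun z => ?_⟩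
  · have : Continuous fun z => r / max r ‖z - e‖ :=
      continuous_const.div (by fun_prop) fun z => (hm z).ne'
    fun_prop
  · rw [add_sub_cancel_left, norm_smul, Real.norm_of_nonneg (div_nonneg hr.le (hm z).le),
      div_mul_eq_mul_div, div_le_iff₀ (hm z)]
    exact mul_le_mul_of_nonneg_left (le_max_right _ _) hr.le
  · simp [max_eq_left hz, div_self hr.ne']
  · refine ⟨max r ‖z - e‖ / r, div_nonneg (hm z).le hr.le, ?_⟩
    rw [add_sub_cancel_left, smul_smul, div_mul_div_cancel₀ hr.ne', div_self (hm z).ne', one_smul]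

/-- Solutions of the delay equations `u' t = - F (u (max (t - h) 0))`, bounded uniformly in `h`. -/
theorem IsMonotoneField.exists_delay_approximation [FiniteDimensional ℝ Z]
    (hF : IsMonotoneField F) (hc : Continuous F) {e : Z} (he : F e = 0) (z₀ : Z) {T : ℝ}
    (hT : 0 ≤ T) :
    ∃ M c : ℝ, 0 ≤ M ∧ 0 < c ∧ ∀ h, 0 < h → h ≤ c → ∃ u v : ℝ → Z, u 0 = z₀ ∧ Continuous v ∧
      (∀ t ∈ Icc 0 T, HasDerivAt u (-F (v t)) t ∧ ‖F (v t)‖ ≤ M ∧ ‖u t - v t‖ ≤ M * h) ∧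
      ∀ s ∈ Icc 0 T, ∀ t ∈ Icc 0 T, ‖u t - u s‖ ≤ M * ‖t - s‖ := by
  set r := ‖z₀ - e‖ + 1 with hr
  have hr0 : 0 < r := by positivity
  obtain ⟨ρ, ρc, ρb, ρid, ρc'⟩ := exists_radial_retraction e hr0
  obtain ⟨M, hM⟩ := (isCompact_closedBall e r).exists_bound_of_continuousOn hc.continuousOn
  have hFM : ∀ z, ‖F (ρ z)‖ ≤ M := fun z => hM _ (by simpa [dist_eq_norm] using ρb z)
  have hM0 : 0 ≤ M := (norm_nonneg _).trans (hFM e)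
  -- This bound on `h` gives `2 * M ^ 2 * h * T ≤ 1`, the growth of `‖u - e‖ ^ 2` that the radius `r
  -- = ‖z₀ - e‖ + 1` can absorb.
  refine ⟨M, 1 / (2 * M ^ 2 * T + 1), hM0, by positivity, fun h hh hhc => ?_⟩
  obtain ⟨u, u0, uc, ud⟩ := exists_delay_solution (G := fun z => -F (ρ z)) (by fun_prop) z₀ hh T
  have hlip : ∀ s ∈ Icc 0 T, ∀ t ∈ Icc 0 T, ‖u t - u s‖ ≤ M * ‖t - s‖ := fun s hs t ht =>
    (convex_Icc 0 T).norm_image_sub_le_of_norm_hasDerivWithin_le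
      (fun x hx => (ud x hx).hasDerivWithinAt) (fun x _ => by simpa using hFM _) hs ht
  have hτ : ∀ t ∈ Icc 0 T, max (t - h) 0 ∈ Icc 0 T := fun t ht =>
    ⟨le_max_right _ _, max_le (by linarith [ht.2]) hT⟩
  have hclose : ∀ t ∈ Icc 0 T, ‖u t - u (max (t - h) 0)‖ ≤ M * h := fun t ht => by
    refine (hlip _ (hτ t ht) t ht).trans (mul_le_mul_of_nonneg_left ?_ hM0)
    rw [Real.norm_eq_abs, abs_le]
    constructor
    · linarith [max_le (show t - h ≤ t by linarith) ht.1]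
    · linarith [le_max_left (t - h) 0]
  -- The retraction is radial, so monotonicity against `e` still gives `⟪v - e, F (ρ v)⟫ ≥ 0` at the
  -- delayed state `v`. Only the delay error `u - v` can push `u` outwards; `u` therefore never
  -- leaves the ball, and `ρ` acts as the identity along it.
  have hball : ∀ t ∈ Icc 0 T, ‖u t - e‖ ≤ r := fun t ht => by
    have := image_sub_le_of_hasDerivWithinAt_le (convex_Icc 0 T) (C := 2 * (M * h * M))
      (fun t ht => ((ud t ht).sub_const e).norm_sq.hasDerivWithinAt) (fun t ht => by
        obtain ⟨k, hk, hk'⟩ := ρc' (u (max (t - h) 0))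
        have h1 : 0 ≤ inner ℝ (u (max (t - h) 0) - e) (F (ρ (u (max (t - h) 0)))) := by
          have := hF (ρ (u (max (t - h) 0))) e
          rw [he, sub_zero, real_inner_comm] at this
          rw [hk', real_inner_smul_left]
          exact mul_nonneg hk this
        have h2 := abs_le.1 ((abs_real_inner_le_norm (u t - u (max (t - h) 0))
          (F (ρ (u (max (t - h) 0))))).trans
            (mul_le_mul (hclose t ht) (hFM _) (norm_nonneg _) (by positivity)))
        have h3 : u t - e = (u (max (t - h) 0) - e) + (u t - u (max (t - h) 0)) := by abel
        rw [inner_neg_right, h3, inner_add_left]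
        linarith [h2.1]) (left_mem_Icc.2 hT) ht ht.1
    rw [u0, sub_zero] at this
    have h4 : 2 * (M * h * M) * t ≤ 1 := by
      rw [le_div_iff₀ (by positivity)] at hhc
      have : 2 * (M * h * M) * t ≤ 2 * (M * h * M) * T :=
        mul_le_mul_of_nonneg_left ht.2 (by positivity)
      nlinarith
    refine (sq_le_sq₀ (norm_nonneg _) hr0.le).1 ?_
    rw [hr]
    nlinarith [norm_nonneg (z₀ - e)]
  have hid : ∀ t ∈ Icc 0 T, ρ (u (max (t - h) 0)) = u (max (t - h) 0) := fun t ht =>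
    ρid _ (hball _ (hτ t ht))
  refine ⟨u, fun t => u (max (t - h) 0), u0, by fun_prop, fun t ht => ⟨?_, ?_, hclose t ht⟩, hlip⟩
  · simpa only [hid t ht] using ud t ht
  · simpa only [hid t ht] using hFM (u (max (t - h) 0))

/-- Replacing `u - u'` by `v - v'` in the derivative of `‖u - u'‖ ^ 2` leaves a term of good sign by
monotonicity and an error of at most `2 * (M * h + M * k) * (2 * M)`. No Lipschitz constant of `F`
enters. -/
theorem IsMonotoneField.delay_approximation_sub_le (hF : IsMonotoneField F) {T M h k : ℝ}
    (hT : 0 ≤ T) (hM : 0 ≤ M)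
    (hh : 0 ≤ h) (hk : 0 ≤ k) {u v u' v' : ℝ → Z} (h0 : u 0 = u' 0)
    (hu : ∀ t ∈ Icc 0 T, HasDerivAt u (-F (v t)) t ∧ ‖F (v t)‖ ≤ M ∧ ‖u t - v t‖ ≤ M * h)
    (hu' : ∀ t ∈ Icc 0 T, HasDerivAt u' (-F (v' t)) t ∧ ‖F (v' t)‖ ≤ M ∧ ‖u' t - v' t‖ ≤ M * k)
    {t : ℝ} (ht : t ∈ Icc 0 T) : ‖u t - u' t‖ ^ 2 ≤ 4 * M ^ 2 * T * (h + k) := by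
  have := image_sub_le_of_hasDerivWithinAt_le (convex_Icc 0 T)
    (C := 2 * ((M * h + M * k) * (M + M)))
    (fun t ht => ((hu t ht).1.fun_sub (hu' t ht).1).norm_sq.hasDerivWithinAt) (fun t ht => by
      obtain ⟨-, a2, a3⟩ := hu t ht
      obtain ⟨-, b2, b3⟩ := hu' t ht
      have h1 := hF (v t) (v' t)
      rw [real_inner_comm] at h1
      have h2 := abs_le.1 ((abs_real_inner_le_norm ((u t - v t) - (u' t - v' t))
        (F (v t) - F (v' t))).trans (mul_le_mul ((norm_sub_le _ _).trans (add_le_add a3 b3))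
          ((norm_sub_le _ _).trans (add_le_add a2 b2)) (norm_nonneg _) (by positivity)))
      have h3 : -F (v t) - -F (v' t) = -(F (v t) - F (v' t)) := by abel
      have h4 : u t - u' t = (v t - v' t) + ((u t - v t) - (u' t - v' t)) := by abel
      rw [h3, inner_neg_right, h4, inner_add_left]
      linarith [h2.1]) (left_mem_Icc.2 hT) ht ht.1
  simp only [h0, sub_self, norm_zero, sub_zero] at this
  have h5 : 2 * ((M * h + M * k) * (M + M)) * t ≤ 2 * ((M * h + M * k) * (M + M)) * T :=
    mul_le_mul_of_nonneg_left ht.2 (by positivity)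
  nlinarith

theorem IsMonotoneField.exists_isFlowLine_Icc [FiniteDimensional ℝ Z]
    (hF : IsMonotoneField F) (hc : Continuous F) {e : Z} (he : F e = 0) (z₀ : Z) {T : ℝ}
    (hT : 0 ≤ T) : ∃ z, IsFlowLine F (Icc 0 T) z ∧ z 0 = z₀ := by
  obtain ⟨M, c, hM, hc0, H⟩ := hF.exists_delay_approximation hc he z₀ hT
  set η : ℕ → ℝ := fun n => c / (n + 1) with hη
  have hη0 : ∀ n, 0 < η n := fun n => by positivity
  have hηanti : Antitone η := fun a b hab => by
    have : (a : ℝ) ≤ b := by exact_mod_cast hab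
    exact div_le_div_of_nonneg_left hc0.le (by positivity) (by linarith)
  have hηc : ∀ n, η n ≤ c := fun n => by simpa [hη] using hηanti (Nat.zero_le n)
  have hηlim : Tendsto η atTop (𝓝 0) := by
    simpa [hη, div_eq_mul_inv] using tendsto_one_div_add_atTop_nhds_zero_nat.const_mul c
  choose u v u0 vc hu ulip using fun n => H (η n) (hη0 n) (hηc n)
  have hcauchy : ∀ t ∈ Icc 0 T, ∃ y, Tendsto (fun n => u n t) atTop (𝓝 y) := by
    intro t ht
    refine cauchySeq_tendsto_of_complete (cauchySeq_of_le_tendsto_0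
      (fun N => √(4 * M ^ 2 * T * (η N + η N))) (fun n m N hn hm => ?_) ?_)
    · rw [dist_eq_norm]
      refine Real.le_sqrt_of_sq_le ((hF.delay_approximation_sub_le hT hM (hη0 n).le (hη0 m).le
        (by rw [u0, u0]) (hu n) (hu m) ht).trans ?_)
      exact mul_le_mul_of_nonneg_left (add_le_add (hηanti hn) (hηanti hm)) (by positivity)
    · have : Tendsto (fun N => √(4 * M ^ 2 * T * (η N + η N))) atTop
          (𝓝 √(4 * M ^ 2 * T * (0 + 0))) := ((hηlim.add hηlim).const_mul _).sqrt
      simpa using this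
  choose! U hU using hcauchy
  have hv : ∀ t ∈ Icc 0 T, Tendsto (fun n => v n t) atTop (𝓝 (U t)) := by
    intro t ht
    have h1 : Tendsto (fun n => u n t - v n t) atTop (𝓝 0) :=
      squeeze_zero_norm (fun n => (hu n t ht).2.2) (by simpa using hηlim.const_mul M)
    simpa using (hU t ht).sub h1
  have hUc : ContinuousOn U (Icc 0 T) := by
    have : LipschitzOnWith ⟨M, hM⟩ U (Icc 0 T) := LipschitzOnWith.of_dist_le_mul
      fun x hx y hy => by
        rw [dist_eq_norm, dist_eq_norm]
        exact le_of_tendsto ((hU x hx).sub (hU y hy)).norm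
          (Eventually.of_forall fun n => ulip n y hy x hx)
    exact this.continuousOn
  -- Clamping time to `[0, T]` extends the limit continuously to all of `ℝ`, so that its integral is
  -- differentiable at the endpoints too.
  set V : ℝ → Z := fun s => U (max 0 (min s T)) with hV
  have hVc : Continuous V := hUc.comp_continuous (by fun_prop)
    fun s => ⟨le_max_left _ _, max_le hT (min_le_right _ _)⟩
  have hVU : ∀ t ∈ Icc 0 T, V t = U t := fun t ht => by
    simp [hV, min_eq_left ht.2, max_eq_right ht.1]
  have hint : ∀ t ∈ Icc 0 T, z₀ + ∫ s in (0:ℝ)..t, -F (V s) = V t := by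
    intro t ht
    have hsub : uIoc 0 t ⊆ Icc 0 T := by
      rw [uIoc_of_le ht.1]
      exact fun s hs => ⟨hs.1.le, hs.2.trans ht.2⟩
    have h1 : Tendsto (fun n => ∫ s in (0:ℝ)..t, -F (v n s)) atTop
        (𝓝 (∫ s in (0:ℝ)..t, -F (V s))) := by
      refine intervalIntegral.tendsto_integral_filter_of_dominated_convergence (fun _ => M)
        (Eventually.of_forall fun n => ?_) (Eventually.of_forall fun n => ?_)
        intervalIntegrable_const ?_
      · have := vc n
        exact (by fun_prop : Continuous fun s => -F (v n s)).aestronglyMeasurable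
      · exact Eventually.of_forall fun s hs => by simpa using (hu n s (hsub hs)).2.1
      · refine Eventually.of_forall fun s hs => ?_
        rw [hVU s (hsub hs)]
        exact ((hc.tendsto _).comp (hv s (hsub hs))).neg
    have h2 : ∀ n, ∫ s in (0:ℝ)..t, -F (v n s) = u n t - z₀ := fun n => by
      have := vc n
      rw [intervalIntegral.integral_eq_sub_of_hasDerivAt
        (fun s hs => (hu n s (by
          rw [uIcc_of_le ht.1] at hs
          exact ⟨hs.1, hs.2.trans ht.2⟩)).1)
        ((by fun_prop : Continuous fun s => -F (v n s)).intervalIntegrable _ _), u0]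
    simp only [h2] at h1
    rw [tendsto_nhds_unique h1 ((hU t ht).sub_const z₀), hVU t ht]
    abel
  refine ⟨fun t => z₀ + ∫ s in (0:ℝ)..t, -F (V s), fun t ht => ?_, by simp⟩
  have hFV : Continuous fun s => -F (V s) := by fun_prop
  have := (hFV.integral_hasStrictDerivAt 0 t).hasDerivAt.const_add z₀
  simp only [hint t ht]
  exact this.hasDerivWithinAt

theorem IsMonotoneField.exists_isFlowLine [FiniteDimensional ℝ Z]
    (hF : IsMonotoneField F) (hc : Continuous F) {e : Z} (he : F e = 0) (z₀ : Z) :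
    ∃ z, IsFlowLine F (Ici 0) z ∧ z 0 = z₀ := by
  choose w hw w0 using fun k : ℕ =>
    hF.exists_isFlowLine_Icc hc he z₀ (T := (k : ℝ) + 1) (by positivity)
  have hcoh : ∀ j k : ℕ, ∀ t : ℝ, 0 ≤ t → t ≤ j + 1 → t ≤ k + 1 → w j t = w k t := by
    intro j k t h0 hj hk
    have h1 : ∀ i : ℕ, t ≤ i + 1 → IsFlowLine F (Icc 0 t) (w i) := fun i hi =>
      (hw i).mono (Icc_subset_Icc_right hi)
    exact hF.eqOn_of_initial (h1 j hj) (h1 k hk) (by rw [w0, w0]) ⟨h0, le_rfl⟩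
  refine ⟨fun t => w ⌊t⌋₊ t, fun t (ht : 0 ≤ t) => ?_, w0 _⟩
  -- Piece `k` lives on `[0, k + 1]`, so `t` lies strictly before the end of its own piece, which
  -- leaves room for a neighborhood in `Ici 0`.
  have hlt : t < (⌊t⌋₊ : ℝ) + 1 := Nat.lt_floor_add_one t
  set N := ⌊t⌋₊
  have h1 : HasDerivWithinAt (w N) (-F (w N t)) (Ici 0) t :=
    (hw N t ⟨ht, hlt.le⟩).mono_of_mem_nhdsWithin
      (mem_nhdsWithin.2 ⟨Iio ((N : ℝ) + 1), isOpen_Iio, hlt, fun s hs => ⟨hs.2, hs.1.le⟩⟩)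
  refine h1.congr_of_eventuallyEq ?_ rfl
  filter_upwards [mem_nhdsWithin_of_mem_nhds (Iio_mem_nhds hlt), self_mem_nhdsWithin] with s hs hs0
  exact hcoh _ _ s hs0 (Nat.lt_floor_add_one s).le (le_of_lt hs)

/-! ### Convergence of flow lines -/

/-- LaSalle's principle for monotone fields: if only equilibria move at a constant distance from the
equilibrium `e`, then every flow line converges to an equilibrium. -/
theorem IsMonotoneField.exists_tendsto [FiniteDimensional ℝ Z]
    (hF : IsMonotoneField F) (hc : Continuous F) {e : Z} (he : F e = 0)
    (hinv : ∀ w, IsFlowLine F (Ici 0) w → (∀ t, 0 ≤ t → ‖w t - e‖ = ‖w 0 - e‖) → F (w 0) = 0)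
    {z : ℝ → Z} (hz : IsFlowLine F (Ici 0) z) :
    ∃ y, F y = 0 ∧ Tendsto z atTop (𝓝 y) := by
  have hcon : IsFlowLine F (Ici 0) fun _ => e := isFlowLine_const he
  obtain ⟨y, -, φ, hφ, hy⟩ := (isCompact_closedBall e ‖z 0 - e‖).tendsto_subseq
    (x := fun k : ℕ => z k) (fun k => by
      simpa [dist_eq_norm] using hF.norm_flow_sub_le hz hcon le_rfl (Nat.cast_nonneg k))
  have hφ' : Tendsto (fun k => (φ k : ℝ)) atTop atTop :=
    tendsto_natCast_atTop_atTop.comp hφ.tendsto_atTop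
  obtain ⟨w, hw, w0⟩ := hF.exists_isFlowLine hc he y
  -- By contraction, the shifted orbit stays as close to `w` as `z (φ k)` is to the cluster point
  -- `y`.
  have hshift : ∀ t, 0 ≤ t → Tendsto (fun k => z (t + φ k)) atTop (𝓝 (w t)) := by
    intro t ht
    rw [tendsto_iff_norm_sub_tendsto_zero] at hy ⊢
    refine squeeze_zero (fun _ => norm_nonneg _) (fun k => ?_) hy
    have := hF.norm_flow_sub_le (hz.comp_add (Nat.cast_nonneg (φ k))) hw le_rfl ht
    simpa [w0] using this
  obtain ⟨ℓ, hℓ⟩ : ∃ ℓ, Tendsto (fun t => ‖z (max t 0) - e‖) atTop (𝓝 ℓ) := by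
    have hanti : Antitone fun t => ‖z (max t 0) - e‖ := fun s t hst =>
      hF.norm_flow_sub_le hz hcon (le_max_right _ _) (max_le_max_right 0 hst)
    exact ⟨_, tendsto_atTop_ciInf hanti ⟨0, by rintro _ ⟨t, rfl⟩; exact norm_nonneg _⟩⟩
  have hconst : ∀ t, 0 ≤ t → ‖w t - e‖ = ℓ := by
    intro t ht
    refine tendsto_nhds_unique ((hshift t ht).sub_const e).norm
      ((hℓ.comp (tendsto_atTop_add_const_left _ t hφ')).congr fun k => ?_)
    simp only [Function.comp_apply]
    rw [max_eq_left (by positivity)]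
  have hy0 : F y = 0 := by
    rw [← w0]
    exact hinv w hw fun t ht => by rw [hconst t ht, hconst 0 le_rfl]
  refine ⟨y, hy0, Metric.tendsto_atTop.2 fun ε hε => ?_⟩
  obtain ⟨k, hk⟩ := ((Metric.tendsto_atTop.1 hy ε hε).imp fun K hK => hK K le_rfl)
  refine ⟨φ k, fun t ht => ?_⟩
  rw [dist_eq_norm]
  -- As `y` is an equilibrium, the distance to it cannot grow after time `φ k`.
  refine (hF.norm_flow_sub_le hz (isFlowLine_const hy0) (Nat.cast_nonneg _) ht).trans_lt ?_
  simpa [dist_eq_norm] using hk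

end

/-! ### Gradients of convex functions -/

section
variable {E : Type*} [NormedAddCommGroup E] [InnerProductSpace ℝ E] [CompleteSpace E]

theorem hasDerivAt_comp_line {f : E → ℝ} (hf : Differentiable ℝ f) (x v : E) (t : ℝ) :
    HasDerivAt (fun s : ℝ => f (x + s • v)) (inner ℝ (gradient f (x + t • v)) v) t := by
  have h1 : HasDerivAt (fun s : ℝ => x + s • v) v t := by
    simpa using ((hasDerivAt_id t).smul_const v).const_add x
  have := (hf (x + t • v)).hasGradientAt.hasFDerivAt.comp_hasDerivAt t h1
  simpa [Function.comp_def] using this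

theorem ContDiff.continuous_gradient {f : E → ℝ} (hf : ContDiff ℝ 1 f) :
    Continuous (gradient f) :=
  (InnerProductSpace.toDual ℝ E).symm.continuous.comp (hf.continuous_fderiv one_ne_zero)

/-- On the line through `x` and `y`, the slope of a convex function lies between its derivatives at
the two ends. -/
theorem ConvexOn.inner_gradient_sub_nonneg {f : E → ℝ} (hc : ConvexOn ℝ univ f)
    (hf : Differentiable ℝ f) (x y : E) :
    0 ≤ inner ℝ (gradient f x - gradient f y) (x - y) := by
  have hφ : ConvexOn ℝ univ fun s : ℝ => f (y + s • (x - y)) := by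
    refine ⟨convex_univ, fun a _ b _ μ ν hμ hν hμν => ?_⟩
    have := hc.2 (mem_univ (y + a • (x - y))) (mem_univ (y + b • (x - y))) hμ hν hμν
    convert this using 2
    obtain rfl : ν = 1 - μ := by linarith
    module
  have h0 := hφ.le_slope_of_hasDerivAt (mem_univ _) (mem_univ _) zero_lt_one
    (hasDerivAt_comp_line hf y (x - y) 0)
  have h1 := hφ.slope_le_of_hasDerivAt (mem_univ _) (mem_univ _) zero_lt_one
    (hasDerivAt_comp_line hf y (x - y) 1)
  simp only [zero_smul, add_zero, one_smul, add_sub_cancel] at h0 h1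
  rw [inner_sub_left]
  linarith

end

namespace EdgeAgreementProblem

variable {m n : ℕ} (p : EdgeAgreementProblem m n)

theorem hasDerivAt_objective_line (hf : ∀ i, Differentiable ℝ (p.f i))
    (x v : Fin m → EuclideanSpace ℝ (Fin n)) (t : ℝ) :
    HasDerivAt (fun s : ℝ => p.objective (x + s • v))
      (∑ i, inner ℝ (gradient (p.f i) (x i + t • v i)) (v i)) t :=
  HasDerivAt.fun_sum fun i _ => hasDerivAt_comp_line (hf i) (x i) (v i) t

/-- The same slope comparison, now strict, for the total objective, since strict convexity is
assumed of the sum. -/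
theorem sum_inner_gradient_sub_pos (hf : ∀ i, Differentiable ℝ (p.f i))
    (hstrict : StrictConvexOn ℝ univ p.objective) {x y : Fin m → EuclideanSpace ℝ (Fin n)}
    (hxy : x ≠ y) :
    0 < ∑ i, inner ℝ (gradient (p.f i) (x i) - gradient (p.f i) (y i)) (x i - y i) := by
  have hφ : StrictConvexOn ℝ univ fun s : ℝ => p.objective (y + s • (x - y)) := by
    refine ⟨convex_univ, fun a _ b _ hab μ ν hμ hν hμν => ?_⟩
    have := hstrict.2 (mem_univ (y + a • (x - y))) (mem_univ (y + b • (x - y)))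
      (fun h => hab (smul_left_injective ℝ (sub_ne_zero.2 hxy) (add_left_cancel h))) hμ hν hμν
    convert this using 2
    obtain rfl : ν = 1 - μ := by linarith
    module
  have h0 := hφ.lt_slope_of_hasDerivAt (mem_univ _) (mem_univ _) zero_lt_one
    (p.hasDerivAt_objective_line hf y (x - y) 0)
  have h1 := hφ.slope_lt_of_hasDerivAt (mem_univ _) (mem_univ _) zero_lt_one
    (p.hasDerivAt_objective_line hf y (x - y) 1)
  simp only [zero_smul, add_zero, one_smul, Pi.sub_apply, add_sub_cancel] at h0 h1
  simp only [inner_sub_left, Finset.sum_sub_distrib]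
  linarith

/-! ### Edge projections, the weighted Laplacian and multipliers -/

theorem mul_P {i j : Fin m} (hr : IsUnit (p.A i j * (p.A i j)ᵀ)) :
    p.A i j * p.P i j = p.A i j := by
  rw [P, ← Matrix.mul_assoc, ← Matrix.mul_assoc,
    Matrix.mul_nonsing_inv _ ((Matrix.isUnit_iff_isUnit_det _).1 hr), Matrix.one_mul]

theorem P_transpose (i j : Fin m) : (p.P i j)ᵀ = p.P i j := by
  simp [P, Matrix.transpose_mul, Matrix.transpose_nonsing_inv, Matrix.mul_assoc]

theorem P_mul_P {i j : Fin m} (hr : IsUnit (p.A i j * (p.A i j)ᵀ)) :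
    p.P i j * p.P i j = p.P i j := by
  conv_lhs => enter [1]; rw [P]
  rw [Matrix.mul_assoc, p.mul_P hr, P]

theorem P_swap (hcons : p.Consistent) {i j : Fin m} (h : p.G.Adj i j) : p.P i j = p.P j i := by
  -- The dimensions `d i j` and `d j i` are only propositionally equal; as free variables they can
  -- be identified by `rfl`.
  have key : ∀ {k l : ℕ} (h : k = l) (A : Matrix (Fin k) (Fin n) ℝ) (B : Matrix (Fin l) (Fin n) ℝ),
      A = B.submatrix (Fin.cast h) id → Aᵀ * (A * Aᵀ)⁻¹ * A = Bᵀ * (B * Bᵀ)⁻¹ * B := by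
    rintro k _ rfl A B rfl
    rfl
  obtain ⟨hd, hA, -⟩ := hcons i j h
  exact key hd _ _ hA

theorem inner_P_comm (i j : Fin m) (x y : EuclideanSpace ℝ (Fin n)) :
    inner ℝ x (toEuclideanLin (p.P i j) y) = inner ℝ y (toEuclideanLin (p.P i j) x) := by
  have hs : (toEuclideanLin (p.P i j)).IsSymmetric :=
    isSymmetric_toEuclideanLin_iff.2 (by
      rw [Matrix.IsHermitian, Matrix.conjTranspose_eq_transpose_of_trivial, p.P_transpose])
  rw [← hs, real_inner_comm]

theorem P_P_apply {i j : Fin m} (hr : IsUnit (p.A i j * (p.A i j)ᵀ))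
    (x : EuclideanSpace ℝ (Fin n)) :
    toEuclideanLin (p.P i j) (toEuclideanLin (p.P i j) x) = toEuclideanLin (p.P i j) x := by
  simp only [toLpLin_apply, mulVec_mulVec, p.P_mul_P hr]

theorem inner_P_self {i j : Fin m} (hr : IsUnit (p.A i j * (p.A i j)ᵀ))
    (x : EuclideanSpace ℝ (Fin n)) :
    inner ℝ x (toEuclideanLin (p.P i j) x) = ‖toEuclideanLin (p.P i j) x‖ ^ 2 := by
  rw [← real_inner_self_eq_norm_sq, p.inner_P_comm i j (toEuclideanLin (p.P i j) x) x,
    p.P_P_apply hr]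

open scoped Classical in
-- Every edge is met from both ends: exchanging `i` and `j` and using `P i j = P j i` gives a second
-- form of the sum, and the two are added.
theorem two_mul_sum_inner_multiplierTerm (hcons : p.Consistent)
    (x y : Fin m → EuclideanSpace ℝ (Fin n)) :
    2 * ∑ i, inner ℝ (x i) (p.multiplierTerm y i) =
      ∑ i, ∑ j ∈ p.G.neighborFinset i,
        inner ℝ (x i - x j) (toEuclideanLin (p.P i j) (y i - y j)) := by
  have h1 : ∑ i, inner ℝ (x i) (p.multiplierTerm y i) = ∑ i, ∑ j, if p.G.Adj i j then
      inner ℝ (x i) (toEuclideanLin (p.P i j) (y i - y j)) else 0 := by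
    refine Finset.sum_congr rfl fun i _ => ?_
    rw [multiplierTerm, inner_sum, SimpleGraph.neighborFinset_eq_filter, Finset.sum_filter]
  have h2 : ∑ i, inner ℝ (x i) (p.multiplierTerm y i) = ∑ i, ∑ j, if p.G.Adj i j then
      - inner ℝ (x j) (toEuclideanLin (p.P i j) (y i - y j)) else 0 := by
    rw [h1, Finset.sum_comm]
    refine Finset.sum_congr rfl fun i _ => Finset.sum_congr rfl fun j _ => ?_
    by_cases h : p.G.Adj i j
    · rw [if_pos h, if_pos h.symm, p.P_swap hcons h, ← inner_neg_right, ← map_neg, neg_sub]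
    · rw [if_neg h, if_neg fun h' => h h'.symm]
  rw [two_mul]
  nth_rewrite 1 [h1]
  rw [h2, ← Finset.sum_add_distrib]
  refine Finset.sum_congr rfl fun i _ => ?_
  rw [← Finset.sum_add_distrib, SimpleGraph.neighborFinset_eq_filter, Finset.sum_filter]
  refine Finset.sum_congr rfl fun j _ => ?_
  split_ifs
  · rw [inner_sub_left]; ring
  · simp

theorem sum_inner_multiplierTerm_comm (hcons : p.Consistent)
    (x y : Fin m → EuclideanSpace ℝ (Fin n)) :
    ∑ i, inner ℝ (x i) (p.multiplierTerm y i) = ∑ i, inner ℝ (y i) (p.multiplierTerm x i) := by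
  have h1 := p.two_mul_sum_inner_multiplierTerm hcons x y
  have h2 := p.two_mul_sum_inner_multiplierTerm hcons y x
  simp only [p.inner_P_comm _ _ (x _ - x _)] at h1
  linarith

theorem sum_inner_multiplierTerm_self_nonneg (hcons : p.Consistent) (hrank : p.FullRowRank)
    (x : Fin m → EuclideanSpace ℝ (Fin n)) :
    0 ≤ ∑ i, inner ℝ (x i) (p.multiplierTerm x i) := by
  classical
  have h := p.two_mul_sum_inner_multiplierTerm hcons x x
  have : 0 ≤ ∑ i, ∑ j ∈ p.G.neighborFinset i,
      inner ℝ (x i - x j) (toEuclideanLin (p.P i j) (x i - x j)) :=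
    Finset.sum_nonneg fun i _ => Finset.sum_nonneg fun j hj => by
      rw [p.inner_P_self (hrank i j (by simpa using hj))]
      positivity
  linarith

/-- The quadratic form of the Laplacian is a sum of the squares `‖P i j (x i - x j)‖ ^ 2`, so all of
them vanish on its kernel. -/
theorem P_sub_eq_zero_of_multiplierTerm_eq_zero (hcons : p.Consistent) (hrank : p.FullRowRank)
    {x : Fin m → EuclideanSpace ℝ (Fin n)} (hx : p.multiplierTerm x = 0) {i j : Fin m}
    (hij : p.G.Adj i j) : toEuclideanLin (p.P i j) (x i - x j) = 0 := by
  classical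
  have h := p.two_mul_sum_inner_multiplierTerm hcons x x
  simp only [hx, Pi.zero_apply, inner_zero_right, Finset.sum_const_zero, mul_zero] at h
  have hnn : ∀ i, ∀ j ∈ p.G.neighborFinset i,
      0 ≤ inner ℝ (x i - x j) (toEuclideanLin (p.P i j) (x i - x j)) := fun i j hj => by
    rw [p.inner_P_self (hrank i j (by simpa using hj))]
    positivity
  have h1 := (Finset.sum_eq_zero_iff_of_nonneg fun i _ => Finset.sum_nonneg (hnn i)).1 h.symm i
    (Finset.mem_univ i)
  have h2 := (Finset.sum_eq_zero_iff_of_nonneg (hnn i)).1 h1 j (by simpa using hij)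
  rw [p.inner_P_self (hrank i j hij)] at h2
  exact norm_eq_zero.1 (pow_eq_zero_iff two_ne_zero |>.1 h2)

theorem agreementTerm_sub (x y : Fin m → EuclideanSpace ℝ (Fin n)) :
    p.agreementTerm x - p.agreementTerm y = p.multiplierTerm (x - y) := by
  funext i
  simp only [agreementTerm, multiplierTerm, Pi.sub_apply, ← Finset.sum_sub_distrib, ← map_sub]
  refine Finset.sum_congr rfl fun j _ => ?_
  congr 1
  abel

theorem agreementTerm_eq_zero_of_mem_feasibleSet (hrank : p.FullRowRank)
    {x : Fin m → EuclideanSpace ℝ (Fin n)} (hx : x ∈ p.feasibleSet) : p.agreementTerm x = 0 := by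
  funext i
  refine Finset.sum_eq_zero fun j hj => ?_
  have hij : p.G.Adj i j := by simpa using hj
  have hb : p.bbar i j = toEuclideanLin (p.P i j) (x i - x j) := by
    rw [bbar, ← hx i j hij, toLpLin_apply, mulVec_mulVec, P]
  rw [map_sub, hb, p.P_P_apply (hrank i j hij), sub_self]

/-- Since `A = A * P`, a kernel vector of the Laplacian is invisible to all constraints. -/
theorem add_mem_feasibleSet (hcons : p.Consistent) (hrank : p.FullRowRank)
    {x v : Fin m → EuclideanSpace ℝ (Fin n)} (hx : x ∈ p.feasibleSet)
    (hv : p.multiplierTerm v = 0) : x + v ∈ p.feasibleSet := by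
  intro i j hij
  have h0 : p.A i j *ᵥ (v i - v j).ofLp = 0 := by
    have := congrArg WithLp.ofLp (p.P_sub_eq_zero_of_multiplierTerm_eq_zero hcons hrank hv hij)
    rw [ofLp_toLpLin, toLin'_apply] at this
    rw [← p.mul_P (hrank i j hij), ← mulVec_mulVec, this]
    simp
  have : (x + v) i - (x + v) j = (x i - x j) + (v i - v j) := by
    simp only [Pi.add_apply]; abel
  rw [this, WithLp.ofLp_add, mulVec_add, hx i j hij, h0, add_zero]

/-- `multiplierTerm` as a linear operator on the Euclidean space of stacked states. -/
noncomputable def multiplierLin : PiLp 2 (fun _ : Fin m => EuclideanSpace ℝ (Fin n)) →ₗ[ℝ]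
    PiLp 2 (fun _ : Fin m => EuclideanSpace ℝ (Fin n)) where
  toFun l := WithLp.toLp 2 (p.multiplierTerm l.ofLp)
  map_add' x y := by
    ext1 i
    simp only [multiplierTerm, WithLp.ofLp_add, Pi.add_apply, ← Finset.sum_add_distrib, ← map_add,
      add_sub_add_comm]
  map_smul' c x := by
    ext1 i
    simp only [multiplierTerm, WithLp.ofLp_smul, Pi.smul_apply, RingHom.id_apply, Finset.smul_sum,
      ← map_smul, smul_sub]

theorem multiplierTerm_sub (x y : Fin m → EuclideanSpace ℝ (Fin n)) :
    p.multiplierTerm (x - y) = p.multiplierTerm x - p.multiplierTerm y := by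
  have := map_sub p.multiplierLin (WithLp.toLp 2 x) (WithLp.toLp 2 y)
  exact congrArg WithLp.ofLp this

theorem multiplierTerm_smul (c : ℝ) (x : Fin m → EuclideanSpace ℝ (Fin n)) :
    p.multiplierTerm (c • x) = c • p.multiplierTerm x :=
  congrArg WithLp.ofLp (map_smul p.multiplierLin c (WithLp.toLp 2 x))

theorem isSymmetric_multiplierLin (hcons : p.Consistent) : p.multiplierLin.IsSymmetric := by
  intro x y
  rw [real_inner_comm, PiLp.inner_apply, PiLp.inner_apply]
  exact p.sum_inner_multiplierTerm_comm hcons y.ofLp x.ofLp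

theorem exists_multiplier (hcons : p.Consistent) (hrank : p.FullRowRank)
    (hf : ∀ i, Differentiable ℝ (p.f i)) {x : Fin m → EuclideanSpace ℝ (Fin n)}
    (hx : p.IsSolution x) :
    ∃ l, ∀ i, gradient (p.f i) (x i) + p.multiplierTerm l i = 0 := by
  set g : PiLp 2 (fun _ : Fin m => EuclideanSpace ℝ (Fin n)) :=
    WithLp.toLp 2 fun i => gradient (p.f i) (x i) with hg
  -- For a symmetric operator the range is the orthogonal complement of the kernel. Kernel
  -- directions stay feasible, so the objective is stationary along them.
  have hmem : g ∈ LinearMap.range p.multiplierLin := by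
    rw [← Submodule.orthogonal_orthogonal (LinearMap.range p.multiplierLin),
      (p.isSymmetric_multiplierLin hcons).orthogonal_range, Submodule.mem_orthogonal]
    intro v hv
    have hv0 : p.multiplierTerm v.ofLp = 0 := congrArg WithLp.ofLp (LinearMap.mem_ker.1 hv)
    have hmin : IsLocalMin (fun s : ℝ => p.objective (x + s • v.ofLp)) 0 :=
      Eventually.of_forall fun s => by
        have := hx.2 (p.add_mem_feasibleSet hcons hrank hx.1 (v := s • v.ofLp)
          (by rw [multiplierTerm_smul, hv0, smul_zero]))
        simpa using this
    have := hmin.hasDerivAt_eq_zero (p.hasDerivAt_objective_line hf x v.ofLp 0)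
    rw [real_inner_comm, PiLp.inner_apply]
    simpa [hg] using this
  obtain ⟨l, hl⟩ := hmem
  refine ⟨-l.ofLp, fun i => ?_⟩
  have h1 : p.multiplierTerm l.ofLp i = gradient (p.f i) (x i) :=
    congrFun (congrArg WithLp.ofLp hl) i
  have h2 := congrFun (p.multiplierTerm_smul (-1) l.ofLp) i
  rw [neg_one_smul] at h2
  rw [h2, Pi.smul_apply, h1, neg_one_smul, add_neg_cancel]

end EdgeAgreementProblem

/-! ### The primal-dual dynamics as a monotone flow -/

theorem hasDerivWithinAt_piLp_iff {ι E : Type*} [Fintype ι] [NormedAddCommGroup E]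
    [NormedSpace ℝ E] {z : ℝ → PiLp 2 (fun _ : ι => E)} {z' : PiLp 2 (fun _ : ι => E)} {S : Set ℝ}
    {t : ℝ} :
    HasDerivWithinAt z z' S t ↔ ∀ i, HasDerivWithinAt (fun s => z s i) (z' i) S t := by
  constructor
  · intro h i
    exact (PiLp.proj 2 (𝕜 := ℝ) (fun _ : ι => E) i).hasFDerivAt.comp_hasDerivWithinAt t h
  · intro h
    exact (PiLp.continuousLinearEquiv 2 ℝ (fun _ : ι => E)).symm.toContinuousLinearMap.hasFDerivAt
      |>.comp_hasDerivWithinAt t (hasDerivWithinAt_pi.2 h)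

namespace EdgeAgreementProblem

variable {m n : ℕ} (p : EdgeAgreementProblem m n)

/-- The monotone field `F` on the space of pairs `(x, l)` for which the primal-dual dynamics reads
`z' = - F z`. -/
noncomputable def saddleField (z : PiLp 2 (fun _ : Fin m ⊕ Fin m => EuclideanSpace ℝ (Fin n))) :
    PiLp 2 (fun _ : Fin m ⊕ Fin m => EuclideanSpace ℝ (Fin n)) :=
  WithLp.toLp 2 (Sum.elim
    (fun i => gradient (p.f i) (z (Sum.inl i)) + p.multiplierTerm (fun j => z (Sum.inr j)) i +
      p.agreementTerm (fun j => z (Sum.inl j)) i)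
    (fun i => - p.agreementTerm (fun j => z (Sum.inl j)) i))

theorem continuous_saddleField (hsmooth : ∀ i, ContDiff ℝ 1 (p.f i)) :
    Continuous p.saddleField := by
  have hg := fun i => (hsmooth i).continuous_gradient
  have hP : ∀ i j, Continuous (toEuclideanLin (p.P i j)) := fun i j =>
    LinearMap.continuous_of_finiteDimensional _
  refine (PiLp.continuous_toLp 2 _).comp (continuous_pi ?_)
  rintro (i | i)
  · simp only [Sum.elim_inl, multiplierTerm, agreementTerm]
    fun_prop
  · simp only [Sum.elim_inr, agreementTerm]
    fun_prop

theorem inner_saddleField_sub (hcons : p.Consistent)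
    (z w : PiLp 2 (fun _ : Fin m ⊕ Fin m => EuclideanSpace ℝ (Fin n))) :
    inner ℝ (p.saddleField z - p.saddleField w) (z - w) =
      ∑ i, inner ℝ (gradient (p.f i) (z (Sum.inl i)) - gradient (p.f i) (w (Sum.inl i)))
        (z (Sum.inl i) - w (Sum.inl i)) +
      ∑ i, inner ℝ (z (Sum.inl i) - w (Sum.inl i))
        (p.multiplierTerm (fun j => z (Sum.inl j) - w (Sum.inl j)) i) := by
  have hA := fun i => congrFun
    (p.agreementTerm_sub (fun j => z (Sum.inl j)) (fun j => w (Sum.inl j))) i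
  have hM := fun i => congrFun
    (p.multiplierTerm_sub (fun j => z (Sum.inr j)) (fun j => w (Sum.inr j))) i
  -- Symmetry of the Laplacian cancels the cross terms between primal and dual differences.
  have hS := p.sum_inner_multiplierTerm_comm hcons (fun j => z (Sum.inl j) - w (Sum.inl j))
    (fun j => z (Sum.inr j) - w (Sum.inr j))
  rw [PiLp.inner_apply, Fintype.sum_sum_type]
  have h1 : ∀ i, inner ℝ ((p.saddleField z - p.saddleField w) (Sum.inl i)) ((z - w) (Sum.inl i)) =
      inner ℝ (gradient (p.f i) (z (Sum.inl i)) - gradient (p.f i) (w (Sum.inl i)))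
        (z (Sum.inl i) - w (Sum.inl i)) +
      inner ℝ (z (Sum.inl i) - w (Sum.inl i))
        (p.multiplierTerm (fun j => z (Sum.inr j) - w (Sum.inr j)) i) +
      inner ℝ (z (Sum.inl i) - w (Sum.inl i))
        (p.multiplierTerm (fun j => z (Sum.inl j) - w (Sum.inl j)) i) := fun i => by
    rw [real_inner_comm _ (z (Sum.inl i) - w (Sum.inl i)),
      real_inner_comm _ (z (Sum.inl i) - w (Sum.inl i)), ← inner_add_left, ← inner_add_left]
    congr 1
    have hA := hA i
    have hM := hM i
    simp only [Pi.sub_apply, Pi.sub_def] at hA hM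
    rw [← hA, hM]
    simp only [saddleField, PiLp.sub_apply, Sum.elim_inl]
    abel
  have h2 : ∀ i, inner ℝ ((p.saddleField z - p.saddleField w) (Sum.inr i)) ((z - w) (Sum.inr i)) =
      - inner ℝ (z (Sum.inr i) - w (Sum.inr i))
        (p.multiplierTerm (fun j => z (Sum.inl j) - w (Sum.inl j)) i) := fun i => by
    rw [real_inner_comm, ← inner_neg_right]
    congr 1
    have hA := hA i
    simp only [Pi.sub_apply, Pi.sub_def] at hA
    rw [← hA]
    simp only [saddleField, PiLp.sub_apply, Sum.elim_inr]
    abel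
  simp only [h1, h2, Finset.sum_add_distrib, Finset.sum_neg_distrib]
  linarith

theorem isMonotoneField_saddleField (hcons : p.Consistent) (hrank : p.FullRowRank)
    (hf : ∀ i, Differentiable ℝ (p.f i)) (hconvex : ∀ i, ConvexOn ℝ univ (p.f i)) :
    IsMonotoneField p.saddleField := fun z w => by
  rw [p.inner_saddleField_sub hcons]
  exact add_nonneg
    (Finset.sum_nonneg fun i _ => (hconvex i).inner_gradient_sub_nonneg (hf i) _ _)
    (p.sum_inner_multiplierTerm_self_nonneg hcons hrank fun j => z (Sum.inl j) - w (Sum.inl j))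

/-- Both parts of the monotonicity gap are nonnegative, and the gradient part is positive unless the
primal parts agree. -/
theorem primal_eq_of_inner_saddleField_sub_eq_zero (hcons : p.Consistent) (hrank : p.FullRowRank)
    (hf : ∀ i, Differentiable ℝ (p.f i)) (hstrict : StrictConvexOn ℝ univ p.objective)
    {z w : PiLp 2 (fun _ : Fin m ⊕ Fin m => EuclideanSpace ℝ (Fin n))}
    (h : inner ℝ (p.saddleField z - p.saddleField w) (z - w) = 0) (i : Fin m) :
    z (Sum.inl i) = w (Sum.inl i) := by
  have hS := p.sum_inner_multiplierTerm_self_nonneg hcons hrank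
    fun j => z (Sum.inl j) - w (Sum.inl j)
  rw [p.inner_saddleField_sub hcons] at h
  by_contra hne
  have := p.sum_inner_gradient_sub_pos hf hstrict (x := fun j => z (Sum.inl j))
    (y := fun j => w (Sum.inl j)) (fun h' => hne (congrFun h' i))
  linarith

theorem isTrajectory_iff_isFlowLine {x l : ℝ → Fin m → EuclideanSpace ℝ (Fin n)} :
    p.IsTrajectory x l ↔
      IsFlowLine p.saddleField (Ici 0) fun t => WithLp.toLp 2 (Sum.elim (x t) (l t)) := by
  refine forall₂_congr fun t _ => ?_
  rw [hasDerivWithinAt_piLp_iff, Sum.forall, forall_and]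
  refine and_congr (forall_congr' fun i => ?_) (forall_congr' fun i => ?_)
  · simp only [saddleField, PiLp.neg_apply, Sum.elim_inl, Sum.elim_inr]
    rw [neg_add, neg_add, sub_eq_add_neg, sub_eq_add_neg]
  · simp only [saddleField, PiLp.neg_apply, Sum.elim_inl, Sum.elim_inr, neg_neg]

/-- A flow line that keeps its distance to an equilibrium starts at an equilibrium. -/
theorem saddleField_eq_zero_of_norm_sub_const (hcons : p.Consistent) (hrank : p.FullRowRank)
    (hf : ∀ i, Differentiable ℝ (p.f i)) (hstrict : StrictConvexOn ℝ univ p.objective)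
    {e : PiLp 2 (fun _ : Fin m ⊕ Fin m => EuclideanSpace ℝ (Fin n))} (he : p.saddleField e = 0)
    {w : ℝ → PiLp 2 (fun _ : Fin m ⊕ Fin m => EuclideanSpace ℝ (Fin n))}
    (hw : IsFlowLine p.saddleField (Ici 0) w) (hconst : ∀ t, 0 ≤ t → ‖w t - e‖ = ‖w 0 - e‖) :
    p.saddleField (w 0) = 0 := by
  -- The derivative of the constant `‖w - e‖ ^ 2` is zero, so the monotonicity gap between `w t` and
  -- `e` vanishes.
  have hx : ∀ t, 0 ≤ t → ∀ i, w t (Sum.inl i) = e (Sum.inl i) := by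
    intro t ht
    have h1 := ((hw t ht).sub_const e).norm_sq
    have h2 : HasDerivWithinAt (fun s => ‖w s - e‖ ^ 2) 0 (Ici 0) t :=
      (hasDerivWithinAt_const t (Ici 0) (‖w 0 - e‖ ^ 2)).congr
        (fun s hs => by rw [hconst s hs]) (by rw [hconst t ht])
    have h3 := (uniqueDiffOn_Ici (0:ℝ) t ht).eq_deriv _ h1 h2
    rw [inner_neg_right, real_inner_comm] at h3
    refine p.primal_eq_of_inner_saddleField_sub_eq_zero hcons hrank hf hstrict ?_
    rw [he, sub_zero]
    linarith
  have h0 : (0:ℝ) ∈ Ici (0:ℝ) := self_mem_Ici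
  ext1 k
  obtain i | i := k
  · have h1 := hasDerivWithinAt_piLp_iff.1 (hw 0 h0) (Sum.inl i)
    have h2 : HasDerivWithinAt (fun s => w s (Sum.inl i)) 0 (Ici 0) 0 :=
      (hasDerivWithinAt_const (0:ℝ) (Ici 0) (e (Sum.inl i))).congr (fun s hs => hx s hs i)
        (hx 0 le_rfl i)
    have := (uniqueDiffOn_Ici (0:ℝ) 0 h0).eq_deriv _ h1 h2
    simpa using this
  -- The dual component of the field depends on the primal part alone, which agrees with that of
  -- `e`.
  · have h1 := congrArg (fun z => z (Sum.inr i)) he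
    simp only [saddleField, Sum.elim_inr, ← hx 0 le_rfl] at h1 ⊢
    exact h1

end EdgeAgreementProblem

end

/-! ### The convergence theorem -/

theorem theorem1 {m n : ℕ} (p : EdgeAgreementProblem m n) (o : p.Orientation)
    (hrank : p.FullRowRank)
    (hexists : ∃ x, p.IsSolution x)
    (hconsistent : p.Consistent)
    (hconnected : p.G.Connected)
    (hwell : o.WellConfigured)
    (hsmooth : ∀ i, ContDiff ℝ 1 (p.f i))
    (hconvex : ∀ i, ConvexOn ℝ Set.univ (p.f i))
    (hstrict : StrictConvexOn ℝ Set.univ p.objective)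
    (x₀ l₀ : Fin m → EuclideanSpace ℝ (Fin n)) :
    (∃ x l, p.IsTrajectory x l ∧ x 0 = x₀ ∧ l 0 = l₀) ∧
    ∀ x l, p.IsTrajectory x l → x 0 = x₀ → l 0 = l₀ →
      (∃ xstar, p.IsSolution xstar ∧
        ∀ i, Filter.Tendsto (fun t => x t i) Filter.atTop (nhds (xstar i))) ∧
      ∃ lstar : Fin m → EuclideanSpace ℝ (Fin n),
        ∀ i, Filter.Tendsto (fun t => l t i) Filter.atTop (nhds (lstar i)) := by
  have hf : ∀ i, Differentiable ℝ (p.f i) := fun i => (hsmooth i).differentiable one_ne_zero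
  have hmono := p.isMonotoneField_saddleField hconsistent hrank hf hconvex
  have hcont := p.continuous_saddleField hsmooth
  obtain ⟨xs, hxs⟩ := hexists
  obtain ⟨ls, hls⟩ := p.exists_multiplier hconsistent hrank hf hxs
  have hagree := p.agreementTerm_eq_zero_of_mem_feasibleSet hrank hxs.1
  set e : PiLp 2 (fun _ : Fin m ⊕ Fin m => EuclideanSpace ℝ (Fin n)) :=
    WithLp.toLp 2 (Sum.elim xs ls)
  have he : p.saddleField e = 0 := by
    ext1 k
    obtain i | i := k
    · simp [EdgeAgreementProblem.saddleField, e, hagree, hls]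
    · simp [EdgeAgreementProblem.saddleField, e, hagree]
  constructor
  · obtain ⟨z, hz, hz0⟩ := hmono.exists_isFlowLine hcont he (WithLp.toLp 2 (Sum.elim x₀ l₀))
    refine ⟨fun t i => z t (Sum.inl i), fun t i => z t (Sum.inr i),
      p.isTrajectory_iff_isFlowLine.2 ?_, by simp [hz0], by simp [hz0]⟩
    convert hz using 2 with t
    ext1 k
    obtain i | i := k <;> rfl
  · intro x l htraj _ _
    obtain ⟨y, hy, hlim⟩ := hmono.exists_tendsto hcont he
      (fun w hw hconst => p.saddleField_eq_zero_of_norm_sub_const hconsistent hrank hf hstrict he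
        hw hconst) (p.isTrajectory_iff_isFlowLine.1 htraj)
    have hcoord := fun k => ((PiLp.continuous_apply 2 _ k).tendsto y).comp hlim
    refine ⟨⟨xs, hxs, fun i => ?_⟩, fun i => y (Sum.inr i), fun i => hcoord (Sum.inr i)⟩
    -- Two equilibria have zero monotonicity gap, so the limit has the primal part of `e`.
    have hyx : y (Sum.inl i) = xs i :=
      p.primal_eq_of_inner_saddleField_sub_eq_zero hconsistent hrank hf hstrict (w := e)
        (by rw [hy, he, sub_zero, inner_zero_left]) i
    rw [← hyx]
    exact hcoord (Sum.inl i)
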